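/- **Proposition (cut elimination for regular $\infty$-proofs).** Formulas are built from propositional variables $p_0,p_1,\dots$ and $\bot$ by means of $\to$, $\Box$ and $\Box^+$. A sequent is an expression $\Sigma;\Gamma\Rightarrow\Delta$, where $\Sigma$ is an arbitrary (possibly infinite) set of formulas and $\Gamma,\Delta$ are finite multisets of formulas. For a multiset $\Gamma=A_1,\dots,A_n$ put $\Box\Gamma:=\Box A_1,\dots,\Box A_n$ and $\Box^+\Gamma:=\Box^+A_1,\dots,\Box^+A_n$. The calculus $\mathsf S+\mathsf{cut}$ has the initial sequents $\Sigma;\Gamma,p\Rightarrow p,\Delta$ (with $p$ a propositional variable) and $\Sigma;\Gamma,\bot\Rightarrow\Delta$, and the following rules, with premises listed from left to right: - $(\to_L)$: from $\Sigma;\Gamma,B\Rightarrow\Delta$ and $\Sigma;\Gamma\Rightarrow A,\Delta$ infer $\Sigma;\Gamma,A\to B\Rightarrow\Delta$; - $(\to_R)$: from $\Sigma;\Gamma,A\Rightarrow B,\Delta$ infer $\Sigma;\Gamma\Rightarrow A\to B,\Delta$; - $(\Box)$: from $\Sigma;\Sigma_0,\Lambda,\Pi,\Box^+\Pi\Rightarrow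 A$ infer $\Sigma;\Phi,\Box\Lambda,\Box^+\Pi\Rightarrow\Box A,\Psi$; - $(\Box^+)$: from $\Sigma;\Sigma_0,\Lambda,\Pi,\Box^+\Pi\Rightarrow A$ and $\Sigma;\Sigma_0,\Lambda,\Pi,\Box^+\Pi\Rightarrow\Box^+A$ infer $\Sigma;\Phi,\Box\Lambda,\Box^+\Pi\Rightarrow\Box^+A,\Psi$, with principal formula $\Box^+A$; - $(\mathsf{cut})$: from $\Sigma;\Gamma\Rightarrow A,\Delta$ and $\Sigma;\Gamma,A\Rightarrow\Delta$ infer $\Sigma;\Gamma\Rightarrow\Delta$. Here $\Sigma_0$ is a finite subset of $\Sigma$. An $\infty$-proof is a (possibly infinite) tree of sequents constructed according to these rules, each node being marked by its sequent and by the rule applied there (with its principal or cut formula), such that every leaf is marked by an initial sequent and every infinite branch has a tail with the following properties: (a) all applications of $(\Box^+)$ in the tail have the same principal formula $\Box^+A$; (b) the tail passes through the right premise of $(\Box^+)$ infinitely many times; (c) the tail does not pass through the left premise of $(\Box^+)$; (d) there are no applications of $(\Box)$ in the tail. An $\infty$-proof is cut-free if it contains no applications of $(\mathsf{cut})$, and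 regular if it contains only finitely many non-isomorphic subtrees. If a sequent $\Sigma;\Gamma\Rightarrow\Delta$ is the root of a regular $\infty$-proof, then it is the root of a regular cut-free $\infty$-proof. -/

import Mathlib

namespace KPlus

/-- Formulas of the bimodal logic of transitive closure: variables `p_0, p_1, …`, `⊥`, `→`, `□`
and `□⁺`. -/
inductive Formula : Type
  | var : ℕ → Formula
  | bot : Formula
  | imp : Formula → Formula → Formula
  | box : Formula → Formula
  | boxPlus : Formula → Formula

/-- A sequent `Σ; Γ ⇒ Δ`: `Σ` is an arbitrary set of formulas, `Γ` and `Δ` are finite multisets. -/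
@[ext]
structure Sequent : Type where
  sig : Set Formula
  ante : Multiset Formula
  succ : Multiset Formula

/-- The name of the rule applied at a node of a proof tree, with its principal formula
(`A → B` for the rules of implication, `□ A` for `box A`, `□⁺ A` for `boxPlus A`), respectively
with its cut formula. `init` marks initial sequents, which are the leaves. -/
inductive Rule : Type
  | init : Rule
  | impL : Formula → Formula → Rule
  | impR : Formula → Formula → Rule
  | box : Formula → Rule
  | boxPlus : Formula → Rule
  | cut : Formula → Rule

/-- `Inference r ps s`: the sequent `s` follows by the rule `r` of `S + cut` from the list `ps` of
premises (from left to right). The parameter `S` is the component `Σ`, and `S₀` is the finite subset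
`Σ₀` of `Σ` in the modal rules. -/
inductive Inference : Rule → List Sequent → Sequent → Prop
  | initVar (S : Set Formula) (Γ Δ : Multiset Formula) (p : ℕ) :
      Inference .init [] ⟨S, Γ + {.var p}, {.var p} + Δ⟩
  | initBot (S : Set Formula) (Γ Δ : Multiset Formula) :
      Inference .init [] ⟨S, Γ + {.bot}, Δ⟩
  | impL (S : Set Formula) (Γ Δ : Multiset Formula) (A B : Formula) :
      Inference (.impL A B) [⟨S, Γ + {B}, Δ⟩, ⟨S, Γ, {A} + Δ⟩] ⟨S, Γ + {.imp A B}, Δ⟩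
  | impR (S : Set Formula) (Γ Δ : Multiset Formula) (A B : Formula) :
      Inference (.impR A B) [⟨S, Γ + {A}, {B} + Δ⟩] ⟨S, Γ, {.imp A B} + Δ⟩
  | box (S : Set Formula) (S₀ : Finset Formula) (hS₀ : (S₀ : Set Formula) ⊆ S)
      (Φ Λ Θ Ψ : Multiset Formula) (A : Formula) :
      Inference (.box A)
        [⟨S, S₀.val + Λ + Θ + Θ.map .boxPlus, {A}⟩]
        ⟨S, Φ + Λ.map .box + Θ.map .boxPlus, {.box A} + Ψ⟩
  | boxPlus (S : Set Formula) (S₀ : Finset Formula) (hS₀ : (S₀ : Set Formula) ⊆ S)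
      (Φ Λ Θ Ψ : Multiset Formula) (A : Formula) :
      Inference (.boxPlus A)
        [⟨S, S₀.val + Λ + Θ + Θ.map .boxPlus, {A}⟩,
          ⟨S, S₀.val + Λ + Θ + Θ.map .boxPlus, {.boxPlus A}⟩]
        ⟨S, Φ + Λ.map .box + Θ.map .boxPlus, {.boxPlus A} + Ψ⟩
  | cut (S : Set Formula) (Γ Δ : Multiset Formula) (A : Formula) :
      Inference (.cut A) [⟨S, Γ, {A} + Δ⟩, ⟨S, Γ + {A}, Δ⟩] ⟨S, Γ, Δ⟩

/-- The marking of a node of a proof tree: its sequent and the rule applied there. -/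
structure Mark : Type where
  sequent : Sequent
  rule : Rule

/-- The node reached after `n` steps on the branch `β` (at step `k` the branch passes to the
premise with number `β k`). -/
def branchNode (β : ℕ → ℕ) (n : ℕ) : List ℕ := (List.range n).map β

/-- An ∞-proof of `S + cut`. A node is the list of the numbers of the premises chosen on the path
from the root to it, so `a ++ [0]` and `a ++ [1]` are the left (or only) and the right premise of
`a`; `node a` is the mark of `a`, and `none` if the tree has no such node. -/
structure InfProof : Type where
  node : List ℕ → Option Mark
  root_isSome : (node []).isSome
  node_closed : ∀ a i, node a = none → node (a ++ [i]) = none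
  inference : ∀ a m, node a = some m → ∃ ps : List Sequent, Inference m.rule ps m.sequent ∧
    ∀ i : ℕ, (node (a ++ [i])).map Mark.sequent = ps[i]?
  /-- Every infinite branch has a tail that satisfies the conditions: (a) all applications of `□⁺`
  in it have the same principal formula `□⁺ A`; (b) it passes through the right premise of `□⁺`
  infinitely many times; (c) it never passes through the left premise of `□⁺`; (d) there are no
  applications of `□` in it. -/
  branch : ∀ β : ℕ → ℕ, (∀ n, (node (branchNode β n)).isSome) → ∃ (N : ℕ) (A : Formula),
    (∀ n ≥ N, ∀ m, node (branchNode β n) = some m → ∀ B, m.rule = .boxPlus B → B = A) ∧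
    (∀ k, ∃ n ≥ k, ∃ m B, node (branchNode β n) = some m ∧ m.rule = .boxPlus B ∧ β n = 1) ∧
    (∀ n ≥ N, ∀ m B, node (branchNode β n) = some m → m.rule = .boxPlus B → β n ≠ 0) ∧
    (∀ n ≥ N, ∀ m B, node (branchNode β n) = some m → m.rule ≠ .box B)

namespace InfProof

/-- The root of `π` is marked by the sequent `s`. -/
def Proves (π : InfProof) (s : Sequent) : Prop := (π.node []).map Mark.sequent = some s

/-- There are no applications of the cut rule in `π`. -/
def CutFree (π : InfProof) : Prop := ∀ a m A, π.node a = some m → m.rule ≠ .cut A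

/-- The subtree of `π` above the node `a`, re-rooted at the empty list. Two subtrees are isomorphic
(as marked trees) if and only if these functions are equal, since the nodes of a subtree are given
by their positions relative to its root. -/
def subtree (π : InfProof) (a : List ℕ) : List ℕ → Option Mark := fun b => π.node (a ++ b)

/-- `π` has only finitely many non-isomorphic subtrees. -/
def Regular (π : InfProof) : Prop := {t | ∃ a, (π.node a).isSome ∧ t = π.subtree a}.Finite

end InfProof

end KPlus

/-! The argument is semantic: no cut is reduced. Sequents are evaluated in Kripke models where `□⁺`
is the box of the transitive closure, and a cut-free proof is rebuilt from validity by exhaustive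
proof search.

The only infinite datum is `Σ`. A regular proof has finitely many marks, so the set `T` of formulas
of `Σ` occurring in its antecedents is finite, and it contains every `Σ₀` used.

Soundness (`InfProof.not_refutes`): if the end sequent were refuted at a world above which `T`
holds, refuted premises would trace an infinite branch. On its tail every right premise of `□⁺ A`
shortens the distance to a world refuting `A`, and no other step changes the world, which
contradicts (b).

Completeness (`exists_regular_cutFree_of_not_refutes`): with `T` as the only `Σ₀`, cut-free search
stays inside a finite set of sequents. Derivability there is a nested fixed point: a greatest one
(`goodSet`) for a phase following right premises of a single `□⁺ A`, inside a least one (`stage`)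
allowing finitely many changes of phase. Underivable irreducible sequents form a countermodel
(`canonicalModel_truth`). Derivable ones form a finite graph ranked by stages, which unravels to a
regular proof (`exists_regular_of_graph`). -/

namespace KPlus

open Relation

/-! ### Kripke semantics and distances -/

/-- A Kripke model on the set of worlds `W`. -/
structure Model (W : Type) where
  rel : W → W → Prop
  val : W → ℕ → Prop

namespace Model

variable {W : Type} (M : Model W)

/-- Truth of a formula at a world; `□⁺` is interpreted by the transitive closure of the
accessibility relation. -/
def Sat : Formula → W → Prop
  | .var p, w => M.val w p
  | .bot, _ => False
  | .imp A B, w => Sat A w → Sat B w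
  | .box A, w => ∀ u, M.rel w u → Sat A u
  | .boxPlus A, w => ∀ u, TransGen M.rel w u → Sat A u

/-- All formulas in the antecedent are true at `w`, and all formulas in the succedent are false. -/
def Refutes (w : W) (s : Sequent) : Prop :=
  (∀ A ∈ s.ante, M.Sat A w) ∧ ∀ A ∈ s.succ, ¬ M.Sat A w

/-- All formulas of `T` are true at all worlds accessible from `w` in at least one step. -/
def Above (T : Set Formula) (w : W) : Prop :=
  ∀ u, TransGen M.rel w u → ∀ A ∈ T, M.Sat A u

/-- Some path of `n + 1` steps leads from the world to a world where `B` is false. -/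
def FailsAt (B : Formula) : ℕ → W → Prop
  | 0, w => ∃ u, M.rel w u ∧ ¬ M.Sat B u
  | n + 1, w => ∃ u, M.rel w u ∧ FailsAt B n u

theorem exists_failsAt {B : Formula} {w : W} (h : ¬ M.Sat (.boxPlus B) w) :
    ∃ n, M.FailsAt B n w := by
  simp only [Sat, not_forall] at h
  obtain ⟨u, hwu, hu⟩ := h
  induction hwu using TransGen.head_induction_on with
  | single h => exact ⟨0, u, h, hu⟩
  | head h _ ih =>
    obtain ⟨n, hn⟩ := ih
    exact ⟨n + 1, _, h, hn⟩

theorem not_sat_of_failsAt {B : Formula} {n : ℕ} {w : W} (h : M.FailsAt B n w) :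
    ¬ M.Sat (.boxPlus B) w := by
  induction n generalizing w with
  | zero =>
    obtain ⟨u, hwu, hu⟩ := h
    exact fun hs => hu (hs u (.single hwu))
  | succ n ih =>
    obtain ⟨u, hwu, hu⟩ := h
    exact fun hs => ih hu fun v huv => hs v (.head hwu huv)

/-- The length (minus one) of a shortest path to a world where `B` is false. -/
noncomputable def dist (B : Formula) (w : W) : ℕ := sInf {n | M.FailsAt B n w}

/-- The first step of a shortest path. The two alternatives match the left and the right premise of
`□⁺`. -/
theorem exists_rel_dist {B : Formula} {w : W} (h : ¬ M.Sat (.boxPlus B) w) :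
    ∃ u, M.rel w u ∧
      (¬ M.Sat B u ∨ (¬ M.Sat (.boxPlus B) u ∧ M.dist B u < M.dist B w)) := by
  have hm : M.FailsAt B (M.dist B w) w := Nat.sInf_mem (M.exists_failsAt h)
  cases hd : M.dist B w with
  | zero =>
    rw [hd] at hm
    obtain ⟨u, hwu, hu⟩ := hm
    exact ⟨u, hwu, .inl hu⟩
  | succ n =>
    rw [hd] at hm
    obtain ⟨u, hwu, hu⟩ := hm
    exact ⟨u, hwu, .inr ⟨M.not_sat_of_failsAt hu, Nat.lt_succ_of_le (Nat.sInf_le hu)⟩⟩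

theorem Above.of_rel {T : Set Formula} {w u : W} (h : M.Above T w) (hwu : M.rel w u) :
    M.Above T u := fun v huv => h v (.head hwu huv)

/-- Truth of `T` above `w` is needed exactly for `S₀`, which appears in the premise but has no trace
in the conclusion. -/
theorem sat_modal_premise {T : Set Formula} {w u : W} (hT : M.Above T w) (hwu : M.rel w u)
    {S₀ Φ Λ Θ : Multiset Formula} (hS₀ : ∀ A ∈ S₀, A ∈ T)
    (hw : ∀ A ∈ Φ + Λ.map .box + Θ.map .boxPlus, M.Sat A w) :
    ∀ A ∈ S₀ + Λ + Θ + Θ.map .boxPlus, M.Sat A u := by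
  simp only [Multiset.mem_add, Multiset.mem_map] at hw ⊢
  rintro A (((h | h) | h) | ⟨B, h, rfl⟩)
  · exact hT u (.single hwu) A (hS₀ A h)
  · exact hw (.box A) (.inl (.inr ⟨A, h, rfl⟩)) u hwu
  · exact hw (.boxPlus A) (.inr ⟨A, h, rfl⟩) u (.single hwu)
  · exact fun v huv => hw (.boxPlus B) (.inr ⟨B, h, rfl⟩) v (.head hwu huv)

end Model

/-! ### Soundness -/

/-- If the conclusion of an inference is refuted, then so is a premise; in the case of `□⁺`, moving
to the right premise brings us closer to a world refuting the principal formula. -/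
theorem Inference.exists_refuted {W : Type} (M : Model W) {T : Set Formula} {r : Rule}
    {ps : List Sequent} {s : Sequent} (h : Inference r ps s)
    (hp : ∀ q ∈ ps, ∀ A ∈ q.ante, A ∈ q.sig → A ∈ T) {w : W} (hT : M.Above T w)
    (hw : M.Refutes w s) :
    ∃ i q w', ps[i]? = some q ∧ M.Refutes w' q ∧ M.Above T w' ∧
      ((∀ B, r ≠ .box B ∧ r ≠ .boxPlus B) → w' = w) ∧
      ∀ B, r = .boxPlus B → i = 0 ∨ M.dist B w' < M.dist B w := by
  cases h with
  | initVar S Γ Δ p =>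
    exact absurd (hw.1 (.var p) (by simp)) (hw.2 _ (by simp))
  | initBot S Γ Δ => exact (hw.1 .bot (by simp)).elim
  | impL S Γ Δ A B =>
    obtain ⟨h1, h2⟩ := hw
    simp only [Multiset.mem_add, Multiset.mem_singleton] at h1 h2
    by_cases hA : M.Sat A w
    · refine ⟨0, _, w, rfl, ⟨?_, ?_⟩, hT, fun _ => rfl, by simp⟩
      · simp only [Multiset.mem_add, Multiset.mem_singleton]
        rintro C (hC | rfl)
        · exact h1 C (.inl hC)
        · exact h1 _ (.inr rfl) hA
      · exact h2
    · refine ⟨1, _, w, rfl, ⟨fun C hC => h1 C (.inl hC), ?_⟩, hT, fun _ => rfl, by simp⟩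
      simp only [Multiset.mem_add, Multiset.mem_singleton]
      rintro C (rfl | hC)
      · exact hA
      · exact h2 C hC
  | impR S Γ Δ A B =>
    obtain ⟨h1, h2⟩ := hw
    simp only [Multiset.mem_add, Multiset.mem_singleton] at h1 h2
    have h := h2 _ (.inl rfl)
    simp only [Model.Sat, Classical.not_imp] at h
    refine ⟨0, _, w, rfl, ⟨?_, ?_⟩, hT, fun _ => rfl, by simp⟩
    · simp only [Multiset.mem_add, Multiset.mem_singleton]
      rintro C (hC | rfl)
      · exact h1 C hC
      · exact h.1
    · simp only [Multiset.mem_add, Multiset.mem_singleton]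
      rintro C (rfl | hC)
      · exact h.2
      · exact h2 C (.inr hC)
  | box S S₀ hS₀ Φ Λ Θ Ψ A =>
    have h := hw.2 (.box A) (by simp)
    simp only [Model.Sat, not_forall] at h
    obtain ⟨u, hwu, hu⟩ := h
    have hS : ∀ A ∈ S₀.val, A ∈ T := fun A hA =>
      hp _ (List.mem_singleton_self _) A (by simp [Finset.mem_def.2 hA]) (hS₀ hA)
    exact ⟨0, _, u, rfl, ⟨M.sat_modal_premise hT hwu hS hw.1, by simpa using hu⟩,
      hT.of_rel M hwu, fun h => absurd rfl (h A).1, by simp⟩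
  | boxPlus S S₀ hS₀ Φ Λ Θ Ψ A =>
    obtain ⟨u, hwu, hu⟩ := M.exists_rel_dist (hw.2 (.boxPlus A) (by simp))
    have hS : ∀ A ∈ S₀.val, A ∈ T := fun A hA =>
      hp _ List.mem_cons_self A (by simp [Finset.mem_def.2 hA]) (hS₀ hA)
    obtain hu | ⟨hu, hd⟩ := hu
    · exact ⟨0, _, u, rfl, ⟨M.sat_modal_premise hT hwu hS hw.1, by simpa using hu⟩,
        hT.of_rel M hwu, fun h => absurd rfl (h A).2, fun _ _ => .inl rfl⟩
    · refine ⟨1, _, u, rfl, ⟨M.sat_modal_premise hT hwu hS hw.1, by simpa using hu⟩,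
        hT.of_rel M hwu, fun h => absurd rfl (h A).2, ?_⟩
      rintro B ⟨⟩
      exact .inr hd
  | cut S Γ Δ A =>
    obtain ⟨h1, h2⟩ := hw
    -- Excluded middle for the cut formula selects the refuted premise.
    by_cases hA : M.Sat A w
    · refine ⟨1, _, w, rfl, ⟨?_, h2⟩, hT, fun _ => rfl, by simp⟩
      simp only [Multiset.mem_add, Multiset.mem_singleton]
      rintro C (hC | rfl)
      · exact h1 C hC
      · exact hA
    · refine ⟨0, _, w, rfl, ⟨h1, ?_⟩, hT, fun _ => rfl, by simp⟩
      simp only [Multiset.mem_add, Multiset.mem_singleton]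
      rintro C (rfl | hC)
      · exact hA
      · exact h2 C hC

theorem branchNode_succ (β : ℕ → ℕ) (n : ℕ) :
    branchNode β (n + 1) = branchNode β n ++ [β n] := by
  simp [branchNode, List.range_succ]

theorem exists_forall_ge_eq_of_antitone {f : ℕ → ℕ} {N : ℕ}
    (hf : ∀ n ≥ N, f (n + 1) ≤ f n) : ∃ K ≥ N, ∀ n ≥ K, f n = f K := by
  obtain ⟨K, hK, hmin⟩ := (measure f).wf.has_min (Set.Ici N) ⟨N, Set.mem_Ici.2 le_rfl⟩
  refine ⟨K, hK, fun n hn => ?_⟩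
  induction n, hn using Nat.le_induction with
  | base => rfl
  | succ n hn ih =>
    have hn' : N ≤ n := le_trans hK hn
    have h1 : ¬ f (n + 1) < f K := hmin (n + 1) (Nat.le_succ_of_le hn')
    have h2 := hf n hn'
    omega

/-- Soundness: the sequent proved by an ∞-proof is not refuted at a world `w` such that the formulas
of `Σ` occurring in the antecedents of the proof are true above `w`. -/
theorem InfProof.not_refutes {π : InfProof} {s : Sequent} (hs : π.Proves s) {T : Set Formula}
    (hp : ∀ a m, π.node a = some m → ∀ A ∈ m.sequent.ante, A ∈ m.sequent.sig → A ∈ T)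
    {W : Type} (M : Model W) {w : W} (hT : M.Above T w) : ¬ M.Refutes w s := by
  intro hw
  -- Nodes paired with a world refuting them; iterating a choice of refuted premise yields an
  -- infinite branch.
  let X := {x : List ℕ × W // ∃ m, π.node x.1 = some m ∧ M.Refutes x.2 m.sequent ∧ M.Above T x.2}
  have hstep : ∀ x : X, ∃ (i : ℕ) (y : X), y.1.1 = x.1.1 ++ [i] ∧
      ∀ m, π.node x.1.1 = some m →
        ((∀ B, m.rule ≠ .box B ∧ m.rule ≠ .boxPlus B) → y.1.2 = x.1.2) ∧
        ∀ B, m.rule = .boxPlus B → i = 0 ∨ M.dist B y.1.2 < M.dist B x.1.2 := by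
    rintro ⟨⟨a, w⟩, m, hm, hw, hT⟩
    obtain ⟨ps, hinf, hps⟩ := π.inference a m hm
    obtain ⟨i, q, w', hi, hw', hT', h1, h2⟩ := hinf.exists_refuted M (fun q hq => by
      obtain ⟨j, hj⟩ := List.mem_iff_getElem?.1 hq
      have hj' := hps j
      rw [hj] at hj'
      obtain ⟨m', hm', rfl⟩ := Option.map_eq_some_iff.1 hj'
      exact hp _ m' hm') hT hw
    have hi' := hps i
    rw [hi] at hi'
    obtain ⟨m', hm', rfl⟩ := Option.map_eq_some_iff.1 hi'
    refine ⟨i, ⟨⟨a ++ [i], w'⟩, m', hm', hw', hT'⟩, rfl, fun m₁ hm₁ => ?_⟩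
    obtain rfl : m = m₁ := Option.some.inj (hm.symm.trans hm₁)
    exact ⟨h1, h2⟩
  choose i y hy hprog using hstep
  obtain ⟨m₀, hm₀, rfl⟩ := Option.map_eq_some_iff.1 hs
  let f : ℕ → X := fun n => y^[n] ⟨⟨[], w⟩, m₀, hm₀, hw, hT⟩
  have hf : ∀ n, f (n + 1) = y (f n) := fun n => Function.iterate_succ_apply' _ _ _
  let β : ℕ → ℕ := fun n => i (f n)
  have hβ : ∀ n, branchNode β n = (f n).1.1 := by
    intro n
    induction n with
    | zero => rfl
    | succ n ih => rw [branchNode_succ, ih, hf, hy]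
  have hnode : ∀ n, ∃ m, π.node (branchNode β n) = some m := by
    intro n
    obtain ⟨m, hm, -⟩ := (f n).2
    exact ⟨m, by rw [hβ, hm]⟩
  obtain ⟨N, A, ha, hb, hc, hd⟩ := π.branch β fun n => Option.isSome_iff_exists.2 (hnode n)
  -- Past `N`, (a) fixes the formula whose distance is measured, while (c) and (d) exclude the
  -- premises along which the world could change without that distance dropping.
  have key : ∀ n ≥ N, M.dist A (f (n + 1)).1.2 ≤ M.dist A (f n).1.2 ∧
      ∀ m B, π.node (branchNode β n) = some m → m.rule = .boxPlus B →
        M.dist A (f (n + 1)).1.2 < M.dist A (f n).1.2 := by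
    intro n hn
    obtain ⟨m, hm⟩ := hnode n
    obtain ⟨h1, h2⟩ := hprog (f n) m (by rw [← hβ, hm])
    rw [hf]
    have hlt : ∀ B, m.rule = .boxPlus B → M.dist A (y (f n)).1.2 < M.dist A (f n).1.2 := by
      intro B hB
      obtain rfl := ha n hn m hm B hB
      exact (h2 B hB).resolve_left (hc n hn m B hm hB)
    constructor
    · by_cases h : ∃ B, m.rule = .boxPlus B
      · obtain ⟨B, hB⟩ := h
        exact (hlt B hB).le
      · rw [h1 fun B => ⟨hd n hn m B hm, fun hB => h ⟨B, hB⟩⟩]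
    · intro m' B hm' hB
      obtain rfl : m = m' := Option.some.inj (hm.symm.trans hm')
      exact hlt B hB
  obtain ⟨K, hKN, hK⟩ := exists_forall_ge_eq_of_antitone
    (f := fun n => M.dist A (f n).1.2) fun n hn => (key n hn).1
  obtain ⟨n, hn, m, B, hm, hB, -⟩ := hb K
  have := (key n (by omega)).2 m B hm hB
  exact this.ne ((hK (n + 1) (by omega)).trans (hK n hn).symm)

/-! ### Unravelling finite graphs into regular proofs -/

/-- The end of the path `a` from `v` in a graph with ordered lists of successors. -/
def walk {V : Type} (next : V → List V) : V → List ℕ → Option V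
  | v, [] => some v
  | v, i :: a => (next v)[i]?.bind fun u => walk next u a

theorem walk_append {V : Type} (next : V → List V) (v : V) (a b : List ℕ) :
    walk next v (a ++ b) = (walk next v a).bind fun u => walk next u b := by
  induction a generalizing v with
  | nil => rfl
  | cons i a ih =>
    simp only [List.cons_append, walk, Option.bind_assoc]
    congr 1
    funext u
    exact ih u

theorem walk_concat {V : Type} (next : V → List V) (v : V) (a : List ℕ) (i : ℕ) :
    walk next v (a ++ [i]) = (walk next v a).bind fun u => (next u)[i]? := by
  rw [walk_append]
  congr 1
  funext u
  simp [walk]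

/-- A finite graph of sequents that is locally correct unravels to a regular cut-free ∞-proof, if
it carries a rank that does not increase along edges and stays constant only for rules of
implication, which decrease the weight, and for right premises of `□⁺` with a principal formula that
depends only on the phase of constant rank. -/
theorem exists_regular_of_graph {V : Type} [Finite V] (seq : V → Sequent) (rule : V → Rule)
    (next : V → List V) (hinf : ∀ v, Inference (rule v) ((next v).map seq) (seq v))
    (hcut : ∀ v A, rule v ≠ .cut A) (rank weight : V → ℕ) (form : V → Formula)
    (hprog : ∀ v i u, (next v)[i]? = some u → rank u < rank v ∨
      (rank u = rank v ∧ form u = form v ∧ ((rule v = .boxPlus (form v) ∧ i = 1) ∨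
        (weight u < weight v ∧ ∀ B, rule v ≠ .box B ∧ rule v ≠ .boxPlus B)))) (v₀ : V) :
    ∃ π : InfProof, π.Proves (seq v₀) ∧ π.CutFree ∧ π.Regular := by
  let mark : V → Mark := fun v => ⟨seq v, rule v⟩
  let node : List ℕ → Option Mark := fun a => (walk next v₀ a).map mark
  have hbranch : ∀ β : ℕ → ℕ, (∀ n, (node (branchNode β n)).isSome) → ∃ (N : ℕ) (A : Formula),
      (∀ n ≥ N, ∀ m, node (branchNode β n) = some m → ∀ B, m.rule = .boxPlus B → B = A) ∧
      (∀ k, ∃ n ≥ k, ∃ m B, node (branchNode β n) = some m ∧ m.rule = .boxPlus B ∧ β n = 1) ∧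
      (∀ n ≥ N, ∀ m B, node (branchNode β n) = some m → m.rule = .boxPlus B → β n ≠ 0) ∧
      (∀ n ≥ N, ∀ m B, node (branchNode β n) = some m → m.rule ≠ .box B) := by
    intro β hβ
    have hw : ∀ n, ∃ v, walk next v₀ (branchNode β n) = some v := fun n => by
      have := hβ n
      rw [Option.isSome_map] at this
      exact Option.isSome_iff_exists.1 this
    choose f hf using hw
    have hnode : ∀ n m, node (branchNode β n) = some m → m = mark (f n) := fun n m hm => by
      simpa [node, hf n] using hm.symm
    have hedge : ∀ n, (next (f n))[β n]? = some (f (n + 1)) := fun n => by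
      have := hf (n + 1)
      rwa [branchNode_succ, walk_concat, hf n] at this
    have hstep := fun n => hprog _ _ _ (hedge n)
    -- Once the rank is constant, every edge is an implication step or a right premise of `□⁺` for
    -- the fixed `form`.
    obtain ⟨N, -, hN⟩ := exists_forall_ge_eq_of_antitone (f := fun n => rank (f n)) (N := 0)
      fun n _ => (hstep n).elim le_of_lt fun h => h.1.le
    have hstep' : ∀ n ≥ N, form (f (n + 1)) = form (f n) ∧
        ((rule (f n) = .boxPlus (form (f n)) ∧ β n = 1) ∨ (weight (f (n + 1)) < weight (f n) ∧
          ∀ B, rule (f n) ≠ .box B ∧ rule (f n) ≠ .boxPlus B)) := fun n hn =>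
      ((hstep n).resolve_left fun h => by
        have h1 := hN n hn
        have h2 := hN (n + 1) (by omega)
        omega).2
    have hform : ∀ n ≥ N, form (f n) = form (f N) := by
      intro n hn
      induction n, hn using Nat.le_induction with
      | base => rfl
      | succ n hn ih => rw [(hstep' n hn).1, ih]
    refine ⟨N, form (f N), ?_, ?_, ?_, ?_⟩
    · intro n hn m hm B hB
      obtain rfl := hnode n m hm
      obtain ⟨-, ⟨h, -⟩ | ⟨-, h⟩⟩ := hstep' n hn
      · rw [← hform n hn]
        exact Rule.boxPlus.inj (hB.symm.trans h)
      · exact absurd hB (h B).2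
    · intro k
      -- Without further right premises the weight would decrease forever.
      by_contra! hk
      have hlt : ∀ n ≥ max k N, weight (f (n + 1)) < weight (f n) := by
        intro n hn
        obtain ⟨-, ⟨h, h'⟩ | ⟨h, -⟩⟩ := hstep' n (le_trans (le_max_right _ _) hn)
        · exact absurd h' (hk n (le_trans (le_max_left _ _) hn) (mark (f n)) _
            (by simp [node, hf n]) h)
        · exact h
      obtain ⟨K, hK, hK'⟩ := exists_forall_ge_eq_of_antitone (f := fun n => weight (f n))
        fun n hn => (hlt n hn).le
      exact (hlt K hK).ne (hK' (K + 1) (by omega))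
    · intro n hn m B hm hB
      obtain rfl := hnode n m hm
      obtain ⟨-, ⟨-, h⟩ | ⟨-, h⟩⟩ := hstep' n hn
      · omega
      · exact absurd hB (h B).2
    · intro n hn m B hm hB
      obtain rfl := hnode n m hm
      obtain ⟨-, ⟨h, -⟩ | ⟨-, h⟩⟩ := hstep' n hn
      · exact Rule.noConfusion (hB.symm.trans h)
      · exact (h B).1 hB
  refine ⟨⟨node, rfl, ?_, ?_, hbranch⟩, rfl, ?_, ?_⟩
  · intro a i ha
    have ha' : walk next v₀ a = none := Option.map_eq_none_iff.1 ha
    simp [node, walk_concat, ha']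
  · intro a m hm
    obtain ⟨v, hv, rfl⟩ := Option.map_eq_some_iff.1 hm
    refine ⟨_, hinf v, fun i => ?_⟩
    simp [node, walk_concat, hv, mark, Function.comp_def]
  · intro a m A hm
    obtain ⟨v, hv, rfl⟩ := Option.map_eq_some_iff.1 hm
    exact hcut v A
  -- A subtree depends only on the vertex reached, so there are at most as many subtrees as
  -- vertices.
  · refine (Set.finite_range fun v b => (walk next v b).map mark).subset ?_
    rintro t ⟨a, ha, rfl⟩
    obtain ⟨m, hm⟩ := Option.isSome_iff_exists.1 ha
    obtain ⟨v, hv, rfl⟩ := Option.map_eq_some_iff.1 hm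
    refine ⟨v, ?_⟩
    funext b
    simp [InfProof.subtree, node, walk_append, hv]

/-! ### Sizes, backward implication steps and modal premises -/

noncomputable instance : DecidableEq Formula := Classical.decEq _

/-- The number of nodes of the syntax tree. -/
def Formula.size : Formula → ℕ
  | .var _ => 1
  | .bot => 1
  | .imp A B => A.size + B.size + 1
  | .box A => A.size + 1
  | .boxPlus A => A.size + 1

theorem Formula.size_pos (A : Formula) : 0 < A.size := by
  cases A <;> simp [size]

theorem Formula.box_injective : Function.Injective Formula.box := fun _ _ h => Formula.box.inj h

theorem Formula.boxPlus_injective : Function.Injective Formula.boxPlus :=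
  fun _ _ h => Formula.boxPlus.inj h

/-- The sum of the sizes of the formulas. -/
def multisetSize (Γ : Multiset Formula) : ℕ := (Γ.map Formula.size).sum

@[simp] theorem multisetSize_add (Γ Δ : Multiset Formula) :
    multisetSize (Γ + Δ) = multisetSize Γ + multisetSize Δ := by
  simp [multisetSize]

@[simp] theorem multisetSize_singleton (A : Formula) : multisetSize {A} = A.size := by
  simp [multisetSize]

theorem multisetSize_mono {Γ Δ : Multiset Formula} (h : Γ ≤ Δ) :
    multisetSize Γ ≤ multisetSize Δ := by
  obtain ⟨Θ, rfl⟩ := Multiset.le_iff_exists_add.1 h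
  simp

theorem card_le_multisetSize (Γ : Multiset Formula) : Γ.card ≤ multisetSize Γ := by
  induction Γ using Multiset.induction_on with
  | empty => simp
  | cons A Γ ih =>
    have := A.size_pos
    rw [← Multiset.singleton_add, multisetSize_add, Multiset.card_add, multisetSize_singleton,
      Multiset.card_singleton]
    omega

namespace Sequent

def weight (s : Sequent) : ℕ := multisetSize s.ante + multisetSize s.succ

/-- `s.Red t`: the sequent `t` is a premise of a rule of implication with conclusion `s`. -/
inductive Red : Sequent → Sequent → Prop
  | impL_left (S : Set Formula) (Γ Δ : Multiset Formula) (A B : Formula) :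
      Red ⟨S, Γ + {.imp A B}, Δ⟩ ⟨S, Γ + {B}, Δ⟩
  | impL_right (S : Set Formula) (Γ Δ : Multiset Formula) (A B : Formula) :
      Red ⟨S, Γ + {.imp A B}, Δ⟩ ⟨S, Γ, {A} + Δ⟩
  | impR (S : Set Formula) (Γ Δ : Multiset Formula) (A B : Formula) :
      Red ⟨S, Γ, {.imp A B} + Δ⟩ ⟨S, Γ + {A}, {B} + Δ⟩

/-- No rule of implication has the conclusion `s`. -/
def Irred (s : Sequent) : Prop := ∀ t, ¬ s.Red t

/-- Irreducible sequents obtained by applying the rules of implication backwards. -/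
def Leaf (s v : Sequent) : Prop := Relation.ReflTransGen Red s v ∧ v.Irred

theorem Red.weight_lt {s t : Sequent} (h : s.Red t) : t.weight < s.weight := by
  cases h <;>
    simp only [weight, Formula.size, multisetSize_add, multisetSize_singleton] <;> omega

theorem Red.sig_eq {s t : Sequent} (h : s.Red t) : t.sig = s.sig := by
  cases h <;> rfl

theorem Leaf.of_red {s t v : Sequent} (h : s.Red t) (hv : t.Leaf v) : s.Leaf v :=
  ⟨.head h hv.1, hv.2⟩

theorem Red.mem_ante {s t : Sequent} (h : s.Red t) {A : Formula} (hA : A ∈ s.ante) :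
    A ∈ t.ante ∨ ∃ B C, A = .imp B C ∧ (C ∈ t.ante ∨ B ∈ t.succ) := by
  cases h with
  | impL_left S Γ Δ B C =>
    simp only [Multiset.mem_add, Multiset.mem_singleton] at hA ⊢
    rcases hA with hA | rfl
    · exact .inl (.inl hA)
    · exact .inr ⟨B, C, rfl, .inl (.inr rfl)⟩
  | impL_right S Γ Δ B C =>
    simp only [Multiset.mem_add, Multiset.mem_singleton] at hA ⊢
    rcases hA with hA | rfl
    · exact .inl hA
    · exact .inr ⟨B, C, rfl, .inr (.inl rfl)⟩
  | impR S Γ Δ B C => exact .inl (by simp [hA])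

theorem Red.mem_succ {s t : Sequent} (h : s.Red t) {A : Formula} (hA : A ∈ s.succ) :
    A ∈ t.succ ∨ ∃ B C, A = .imp B C ∧ B ∈ t.ante ∧ C ∈ t.succ := by
  cases h with
  | impL_left S Γ Δ B C => exact .inl hA
  | impL_right S Γ Δ B C => exact .inl (by simp [hA])
  | impR S Γ Δ B C =>
    simp only [Multiset.mem_add, Multiset.mem_singleton] at hA ⊢
    rcases hA with rfl | hA
    · exact .inr ⟨B, C, rfl, .inr rfl, .inl rfl⟩
    · exact .inl (.inr hA)

theorem Irred.imp_notMem_ante {v : Sequent} (h : v.Irred) (A B : Formula) :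
    .imp A B ∉ v.ante := by
  obtain ⟨S, Γ, Δ⟩ := v
  intro hm
  obtain ⟨Θ, rfl⟩ := Multiset.exists_cons_of_mem hm
  rw [← Multiset.singleton_add, add_comm] at h
  exact h _ (.impL_left S Θ Δ A B)

theorem Irred.imp_notMem_succ {v : Sequent} (h : v.Irred) (A B : Formula) :
    .imp A B ∉ v.succ := by
  obtain ⟨S, Γ, Δ⟩ := v
  intro hm
  obtain ⟨Θ, rfl⟩ := Multiset.exists_cons_of_mem hm
  rw [← Multiset.singleton_add] at h
  exact h _ (.impR S Γ Θ A B)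

theorem Leaf.mem_ante {s v : Sequent} (h : s.Leaf v) {A : Formula} (hA : A ∈ s.ante)
    (hi : ∀ B C, A ≠ .imp B C) : A ∈ v.ante := by
  induction h.1 using Relation.ReflTransGen.head_induction_on with
  | refl => exact hA
  | head h' h'' ih =>
    refine ih ⟨h'', h.2⟩ ((h'.mem_ante hA).resolve_right ?_)
    rintro ⟨B, C, hBC, -⟩
    exact hi B C hBC

theorem Leaf.mem_succ {s v : Sequent} (h : s.Leaf v) {A : Formula} (hA : A ∈ s.succ)
    (hi : ∀ B C, A ≠ .imp B C) : A ∈ v.succ := by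
  induction h.1 using Relation.ReflTransGen.head_induction_on with
  | refl => exact hA
  | head h' h'' ih =>
    refine ih ⟨h'', h.2⟩ ((h'.mem_succ hA).resolve_right ?_)
    rintro ⟨B, C, hBC, -⟩
    exact hi B C hBC

/-- Since `v` is irreducible, the implication is decomposed somewhere between `s` and `v`; `t` is
the sequent just after that step. -/
theorem Leaf.imp_mem_ante {s v : Sequent} (h : s.Leaf v) {A B : Formula}
    (hA : .imp A B ∈ s.ante) : ∃ t : Sequent, t.Leaf v ∧ (B ∈ t.ante ∨ A ∈ t.succ) := by
  induction h.1 using Relation.ReflTransGen.head_induction_on with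
  | refl => exact absurd hA (h.2.imp_notMem_ante A B)
  | head h' h'' ih =>
    obtain hA | ⟨_, _, ⟨⟩, hBC⟩ := h'.mem_ante hA
    · exact ih ⟨h'', h.2⟩ hA
    · exact ⟨_, ⟨h'', h.2⟩, hBC⟩

theorem Leaf.imp_mem_succ {s v : Sequent} (h : s.Leaf v) {A B : Formula}
    (hA : .imp A B ∈ s.succ) : ∃ t : Sequent, t.Leaf v ∧ A ∈ t.ante ∧ B ∈ t.succ := by
  induction h.1 using Relation.ReflTransGen.head_induction_on with
  | refl => exact absurd hA (h.2.imp_notMem_succ A B)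
  | head h' h'' ih =>
    obtain hA | ⟨_, _, ⟨⟩, hBC⟩ := h'.mem_succ hA
    · exact ih ⟨h'', h.2⟩ hA
    · exact ⟨_, ⟨h'', h.2⟩, hBC⟩

/-- A sequent that is not irreducible follows by a rule of implication. -/
theorem exists_inference_of_not_irred {s : Sequent} (h : ¬ s.Irred) :
    ∃ r ps, Inference r ps s ∧ (∀ t ∈ ps, s.Red t) ∧
      ∀ A, r ≠ .cut A ∧ r ≠ .box A ∧ r ≠ .boxPlus A := by
  simp only [Irred, not_forall, not_not] at h
  obtain ⟨t, ht⟩ := h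
  cases ht with
  | impL_left S Γ Δ A B | impL_right S Γ Δ A B =>
    refine ⟨_, _, .impL S Γ Δ A B, ?_, by simp⟩
    simp only [List.mem_cons, List.not_mem_nil, or_false]
    rintro t (rfl | rfl)
    · exact .impL_left S Γ Δ A B
    · exact .impL_right S Γ Δ A B
  | impR S Γ Δ A B =>
    refine ⟨_, _, .impR S Γ Δ A B, ?_, by simp⟩
    simp only [List.mem_singleton]
    rintro t rfl
    exact .impR S Γ Δ A B

/-- The formulas `A` such that `□ A` is in the antecedent. -/
noncomputable def unbox (v : Sequent) : Finset Formula :=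
  v.ante.toFinset.preimage .box Formula.box_injective.injOn

/-- The formulas `A` such that `□⁺ A` is in the antecedent. -/
noncomputable def unboxPlus (v : Sequent) : Finset Formula :=
  v.ante.toFinset.preimage .boxPlus Formula.boxPlus_injective.injOn

@[simp] theorem mem_unbox {v : Sequent} {A : Formula} : A ∈ v.unbox ↔ .box A ∈ v.ante := by
  rw [unbox, Finset.mem_preimage, Multiset.mem_toFinset]

@[simp] theorem mem_unboxPlus {v : Sequent} {A : Formula} :
    A ∈ v.unboxPlus ↔ .boxPlus A ∈ v.ante := by
  rw [unboxPlus, Finset.mem_preimage, Multiset.mem_toFinset]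

/-- The premise with succedent `A` of a modal rule with conclusion `v`, where `T` is the chosen
finite subset of `Σ`. -/
noncomputable def premise (T : Finset Formula) (v : Sequent) (A : Formula) : Sequent :=
  ⟨v.sig, T.val + v.unbox.val + v.unboxPlus.val + v.unboxPlus.val.map .boxPlus, {A}⟩

theorem nodup_map_boxPlus (v : Sequent) : (v.unboxPlus.val.map Formula.boxPlus).Nodup :=
  v.unboxPlus.nodup.map Formula.boxPlus_injective

/-- One copy of each boxed formula is kept and repetitions are absorbed by `Φ`. Hence modal premises
are built from sets, which keeps their weight bounded. -/
theorem exists_ante_eq (v : Sequent) :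
    ∃ Φ, v.ante = Φ + v.unbox.val.map .box + v.unboxPlus.val.map .boxPlus := by
  have hnd : (v.unbox.val.map Formula.box + v.unboxPlus.val.map Formula.boxPlus).Nodup := by
    rw [Multiset.nodup_add]
    refine ⟨v.unbox.nodup.map Formula.box_injective, v.nodup_map_boxPlus, ?_⟩
    rw [Multiset.disjoint_left]
    simp only [Multiset.mem_map, not_exists, not_and]
    rintro _ ⟨A, -, rfl⟩ B - ⟨⟩
  have hle : v.unbox.val.map .box + v.unboxPlus.val.map .boxPlus ≤ v.ante := by
    rw [Multiset.le_iff_subset hnd]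
    intro A
    simp only [Multiset.mem_add, Multiset.mem_map, Finset.mem_val, mem_unbox, mem_unboxPlus]
    rintro (⟨B, hB, rfl⟩ | ⟨B, hB, rfl⟩) <;> exact hB
  obtain ⟨Φ, hΦ⟩ := Multiset.le_iff_exists_add.1 hle
  exact ⟨Φ, by rw [hΦ, add_assoc Φ, add_comm Φ]⟩

theorem inference_box {T : Finset Formula} {v : Sequent} (hT : (T : Set Formula) ⊆ v.sig)
    {A : Formula} (hA : .box A ∈ v.succ) : Inference (.box A) [premise T v A] v := by
  obtain ⟨Φ, hΦ⟩ := v.exists_ante_eq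
  obtain ⟨Ψ, hΨ⟩ := Multiset.exists_cons_of_mem hA
  have := Inference.box v.sig T hT Φ v.unbox.val v.unboxPlus.val Ψ A
  rwa [← hΦ, Multiset.singleton_add, ← hΨ] at this

theorem inference_boxPlus {T : Finset Formula} {v : Sequent} (hT : (T : Set Formula) ⊆ v.sig)
    {A : Formula} (hA : .boxPlus A ∈ v.succ) :
    Inference (.boxPlus A) [premise T v A, premise T v (.boxPlus A)] v := by
  obtain ⟨Φ, hΦ⟩ := v.exists_ante_eq
  obtain ⟨Ψ, hΨ⟩ := Multiset.exists_cons_of_mem hA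
  have := Inference.boxPlus v.sig T hT Φ v.unbox.val v.unboxPlus.val Ψ A
  rwa [← hΦ, Multiset.singleton_add, ← hΨ] at this

/-- `v` is an initial sequent. -/
def Initial (v : Sequent) : Prop := (∃ p, .var p ∈ v.ante ∧ .var p ∈ v.succ) ∨ .bot ∈ v.ante

theorem Initial.inference {v : Sequent} (h : v.Initial) : Inference .init [] v := by
  obtain ⟨S, Γ, Δ⟩ := v
  obtain ⟨p, h1, h2⟩ | h := h
  · obtain ⟨Γ, rfl⟩ := Multiset.exists_cons_of_mem h1
    obtain ⟨Δ, rfl⟩ := Multiset.exists_cons_of_mem h2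
    have := Inference.initVar S Γ Δ p
    rwa [add_comm, Multiset.singleton_add, Multiset.singleton_add] at this
  · obtain ⟨Γ, rfl⟩ := Multiset.exists_cons_of_mem h
    have := Inference.initBot S Γ Δ
    rwa [add_comm, Multiset.singleton_add] at this

end Sequent

/-! ### Finiteness -/

/-- A finite set of formulas closed under immediate subformulas. -/
structure SubformulaClosed (C : Finset Formula) : Prop where
  imp : ∀ A B, .imp A B ∈ C → A ∈ C ∧ B ∈ C
  box : ∀ A, .box A ∈ C → A ∈ C
  boxPlus : ∀ A, .boxPlus A ∈ C → A ∈ C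

theorem SubformulaClosed.union {C D : Finset Formula} (hC : SubformulaClosed C)
    (hD : SubformulaClosed D) : SubformulaClosed (C ∪ D) := by
  constructor <;> simp only [Finset.mem_union]
  · rintro A B (h | h)
    · exact ⟨.inl (hC.imp A B h).1, .inl (hC.imp A B h).2⟩
    · exact ⟨.inr (hD.imp A B h).1, .inr (hD.imp A B h).2⟩
  · exact fun A h => h.imp (hC.box A) (hD.box A)
  · exact fun A h => h.imp (hC.boxPlus A) (hD.boxPlus A)

theorem Formula.exists_subformulaClosed (A : Formula) :
    ∃ C : Finset Formula, A ∈ C ∧ SubformulaClosed C := by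
  induction A with
  | var p => exact ⟨{.var p}, by simp, by constructor <;> simp⟩
  | bot => exact ⟨{.bot}, by simp, by constructor <;> simp⟩
  | imp A B ihA ihB =>
    obtain ⟨C, hA, hC⟩ := ihA
    obtain ⟨D, hB, hD⟩ := ihB
    have h := hC.union hD
    refine ⟨insert (.imp A B) (C ∪ D), by simp, ?_, ?_, ?_⟩
    · intro A' B' h'
      obtain h' | h' := Finset.mem_insert.1 h'
      · cases h'
        simp [hA, hB]
      · exact (h.imp _ _ h').imp (Finset.mem_insert_of_mem ·) (Finset.mem_insert_of_mem ·)
    · exact fun A' h' => Finset.mem_insert_of_mem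
        (h.box _ ((Finset.mem_insert.1 h').resolve_left (by simp)))
    · exact fun A' h' => Finset.mem_insert_of_mem
        (h.boxPlus _ ((Finset.mem_insert.1 h').resolve_left (by simp)))
  | box A ih | boxPlus A ih =>
    obtain ⟨C, hA, hC⟩ := ih
    refine ⟨insert _ C, Finset.mem_insert_self _ _, ?_, ?_, ?_⟩
    · exact fun A' B' h' => (hC.imp _ _ ((Finset.mem_insert.1 h').resolve_left (by simp))).imp
        (Finset.mem_insert_of_mem ·) (Finset.mem_insert_of_mem ·)
    all_goals
      intro A' h'
      obtain h' | h' := Finset.mem_insert.1 h'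
      · cases h'
        all_goals exact Finset.mem_insert_of_mem hA
      · first
        | exact Finset.mem_insert_of_mem (hC.box _ h')
        | exact Finset.mem_insert_of_mem (hC.boxPlus _ h')

theorem exists_subformulaClosed (F : Finset Formula) :
    ∃ C : Finset Formula, F ⊆ C ∧ SubformulaClosed C := by
  induction F using Finset.induction_on with
  | empty => exact ⟨∅, by simp, by constructor <;> simp⟩
  | insert A F _ ih =>
    obtain ⟨C, hF, hC⟩ := ih
    obtain ⟨D, hA, hD⟩ := A.exists_subformulaClosed
    refine ⟨C ∪ D, Finset.insert_subset (by simp [hA]) (hF.trans Finset.subset_union_left),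
      hC.union hD⟩

/-- The sequents `S; Γ ⇒ Δ` of weight at most `K` that consist of formulas of `C`. -/
def bounded (S : Set Formula) (C : Finset Formula) (K : ℕ) : Set Sequent :=
  {s | s.sig = S ∧ (∀ A ∈ s.ante, A ∈ C) ∧ (∀ A ∈ s.succ, A ∈ C) ∧ s.weight ≤ K}

/-- Reduces the finiteness of `bounded` to that of the multisets below a fixed one. -/
theorem le_nsmul_of_card_le {C : Finset Formula} {K : ℕ} {Γ : Multiset Formula}
    (h : ∀ A ∈ Γ, A ∈ C) (hK : Γ.card ≤ K) : Γ ≤ K • C.val := by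
  rw [Multiset.le_iff_count]
  intro A
  by_cases hA : A ∈ Γ
  · rw [Multiset.count_nsmul, Multiset.count_eq_one_of_mem C.nodup (h A hA), mul_one]
    exact (Multiset.count_le_card A Γ).trans hK
  · simp [Multiset.count_eq_zero_of_notMem hA]

theorem finite_bounded (S : Set Formula) (C : Finset Formula) (K : ℕ) :
    (bounded S C K).Finite := by
  have hfin := Set.finite_Iic (K • C.val)
  refine ((hfin.prod hfin).image fun p => Sequent.mk S p.1 p.2).subset ?_
  rintro ⟨S', Γ, Δ⟩ ⟨rfl, h1, h2, h3⟩
  simp only [Sequent.weight] at h1 h2 h3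
  have h4 := card_le_multisetSize Γ
  have h5 := card_le_multisetSize Δ
  exact ⟨(Γ, Δ), ⟨le_nsmul_of_card_le h1 (h4.trans (by omega)),
    le_nsmul_of_card_le h2 (h5.trans (by omega))⟩, rfl⟩

theorem bounded_of_red {S : Set Formula} {C : Finset Formula} {K : ℕ} (hC : SubformulaClosed C)
    {s t : Sequent} (h : s.Red t) (hs : s ∈ bounded S C K) : t ∈ bounded S C K := by
  have hw := h.weight_lt
  obtain ⟨h1, h2, h3, h4⟩ := hs
  refine ⟨h.sig_eq.trans h1, ?_, ?_, hw.le.trans h4⟩ <;> clear hw h4 h1 <;> cases h <;>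
    simp only [Multiset.mem_add, Multiset.mem_singleton, or_imp, forall_and, forall_eq] at h2 h3 ⊢
  · exact ⟨h2.1, (hC.imp _ _ h2.2).2⟩
  · exact h2.1
  · exact ⟨h2, (hC.imp _ _ h3.1).1⟩
  · exact h3
  · exact ⟨(hC.imp _ _ h2.2).1, h3⟩
  · exact ⟨(hC.imp _ _ h3.1).2, h3.2⟩

theorem bounded_of_leaf {S : Set Formula} {C : Finset Formula} {K : ℕ} (hC : SubformulaClosed C)
    {s v : Sequent} (h : s.Leaf v) (hs : s ∈ bounded S C K) : v ∈ bounded S C K := by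
  induction h.1 using Relation.ReflTransGen.head_induction_on with
  | refl => exact hs
  | head h' h'' ih => exact ih ⟨h'', h.2⟩ (bounded_of_red hC h' hs)

/-- The factor 5 counts the duplicate-free parts of the premise: `T`, the two unboxed sets, the `□⁺`
formulas and the succedent. Each has size at most that of `C`, whatever the weight of `v`. -/
theorem premise_mem_bounded {S : Set Formula} {C T : Finset Formula} {K : ℕ}
    (hC : SubformulaClosed C) (hT : T ⊆ C) (hK : 5 * multisetSize C.val ≤ K) {v : Sequent}
    (hv : v ∈ bounded S C K) {A : Formula} (hA : A ∈ C) :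
    v.premise T A ∈ bounded S C K := by
  obtain ⟨h1, h2, h3, h4⟩ := hv
  have hb : ∀ B ∈ v.unbox.val, B ∈ C := fun B hB => hC.box B (h2 _ (Sequent.mem_unbox.1 hB))
  have hp : ∀ B ∈ v.unboxPlus.val, B ∈ C := fun B hB =>
    hC.boxPlus B (h2 _ (Sequent.mem_unboxPlus.1 hB))
  have hp' : ∀ B ∈ v.unboxPlus.val.map .boxPlus, B ∈ C := by
    intro B hB
    obtain ⟨B', hB', rfl⟩ := Multiset.mem_map.1 hB
    exact h2 _ (Sequent.mem_unboxPlus.1 hB')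
  refine ⟨h1, ?_, by simpa [Sequent.premise] using hA, ?_⟩
  · simp only [Sequent.premise, Multiset.mem_add]
    rintro B (((h | h) | h) | h)
    exacts [hT h, hb B h, hp B h, hp' B h]
  · have hsize : ∀ {Γ : Multiset Formula}, Γ.Nodup → (∀ B ∈ Γ, B ∈ C) →
        multisetSize Γ ≤ multisetSize C.val := fun hn h =>
      multisetSize_mono ((Multiset.le_iff_subset hn).2 h)
    have e1 := hsize T.nodup hT
    have e2 := hsize v.unbox.nodup hb
    have e3 := hsize v.unboxPlus.nodup hp
    have e4 := hsize v.nodup_map_boxPlus hp'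
    have e5 := hsize (Multiset.nodup_singleton A) (by simpa using hA)
    simp only [Sequent.weight, Sequent.premise, multisetSize_add]
    omega

/-! ### Proof search -/

/-- `v` is initial, or it follows by a modal rule from premises in `P`. -/
def FollowsFrom (T : Finset Formula) (P : Set Sequent) (v : Sequent) : Prop :=
  v.Initial ∨ (∃ B, .box B ∈ v.succ ∧ v.premise T B ∈ P) ∨
    ∃ B, .boxPlus B ∈ v.succ ∧ v.premise T B ∈ P ∧ v.premise T (.boxPlus B) ∈ P

/-- `v` follows by the rule `□⁺` with principal formula `□⁺ A` from a left premise in `P` and a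
right premise in `Y`. -/
def FollowsAlong (T : Finset Formula) (A : Formula) (P Y : Set Sequent) (v : Sequent) : Prop :=
  .boxPlus A ∈ v.succ ∧ v.premise T A ∈ P ∧ v.premise T (.boxPlus A) ∈ Y

/-- All leaves of `s` follow from `P`, or from `P` and `Y` by the rule `□⁺` for `□⁺ A`. -/
def Good (T : Finset Formula) (A : Formula) (P Y : Set Sequent) (s : Sequent) : Prop :=
  ∀ v, s.Leaf v → FollowsFrom T P v ∨ FollowsAlong T A P Y v

/-- The greatest set `Y` of sequents that are good with respect to `P` and `Y`. -/
def goodSet (T : Finset Formula) (A : Formula) (P : Set Sequent) : Set Sequent :=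
  {s | ∃ Y, s ∈ Y ∧ ∀ t ∈ Y, Good T A P Y t}

/-- The stages of the least fixed point of `P ↦ ⋃ A ∈ C, goodSet T A P`. -/
def stage (T C : Finset Formula) : ℕ → Set Sequent
  | 0 => ∅
  | n + 1 => {s | ∃ A ∈ C, s ∈ goodSet T A (stage T C n)}

theorem Good.mono {T : Finset Formula} {A : Formula} {P P' Y Y' : Set Sequent} (hP : P ⊆ P')
    (hY : Y ⊆ Y') {s : Sequent} (h : Good T A P Y s) : Good T A P' Y' s := by
  intro v hv
  obtain (h | ⟨B, h1, h2⟩ | ⟨B, h1, h2, h3⟩) | ⟨h1, h2, h3⟩ := h v hv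
  · exact .inl (.inl h)
  · exact .inl (.inr (.inl ⟨B, h1, hP h2⟩))
  · exact .inl (.inr (.inr ⟨B, h1, hP h2, hP h3⟩))
  · exact .inr ⟨h1, hP h2, hY h3⟩

/-- Knaster–Tarski: the union of all post-fixed points is one itself. -/
theorem good_of_mem_goodSet {T : Finset Formula} {A : Formula} {P : Set Sequent} {s : Sequent}
    (h : s ∈ goodSet T A P) : Good T A P (goodSet T A P) s := by
  obtain ⟨Y, hs, hY⟩ := h
  exact (hY s hs).mono subset_rfl fun t ht => show t ∈ goodSet T A P from ⟨Y, ht, hY⟩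

theorem goodSet_mono {T : Finset Formula} {A : Formula} {P P' : Set Sequent} (hP : P ⊆ P') :
    goodSet T A P ⊆ goodSet T A P' := by
  rintro s ⟨Y, hs, hY⟩
  exact ⟨Y, hs, fun t ht => (hY t ht).mono hP subset_rfl⟩

theorem stage_subset_succ (T C : Finset Formula) (n : ℕ) : stage T C n ⊆ stage T C (n + 1) := by
  induction n with
  | zero => exact Set.empty_subset _
  | succ n ih =>
    rintro s ⟨A, hA, hs⟩
    exact ⟨A, hA, goodSet_mono ih hs⟩

/-- The stages become stationary on every finite set of sequents. -/
theorem exists_stage_stationary (T C : Finset Formula) {F : Set Sequent} (hF : F.Finite) :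
    ∃ N, ∀ s ∈ F, s ∈ stage T C (N + 1) → s ∈ stage T C N := by
  have := hF.to_subtype
  have hmono : Monotone fun n => {s : F | s.1 ∈ stage T C n} :=
    monotone_nat_of_le_succ fun n _ hs => stage_subset_succ T C n hs
  obtain ⟨N, hN⟩ := WellFoundedGT.monotone_chain_condition ⟨_, hmono⟩
  refine ⟨N, fun s hs h => ?_⟩
  have : (⟨s, hs⟩ : F) ∈ {s : F | s.1 ∈ stage T C N} := by
    have e := hN (N + 1) (Nat.le_succ N)
    simp only [OrderHom.coe_mk] at e
    rw [e]
    exact h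
  exact this

/-! ### The canonical model -/

/-- The canonical model: its worlds are irreducible sequents that do not follow from `P`, and the
successors of a world are the leaves of its modal premises. -/
def canonicalModel (T : Finset Formula) (F P : Set Sequent) :
    Model {v : Sequent // v ∈ F ∧ v.Irred ∧ ¬ FollowsFrom T P v} where
  rel v u := ∃ A, (v.1.premise T A).Leaf u.1
  val v p := .var p ∈ v.1.ante

section Canonical

variable {S : Set Formula} {T C : Finset Formula} {K N : ℕ}

/-- A sequent outside a stationary stage has a leaf that does not follow from this stage. -/
theorem exists_leaf_of_notMem_stage (hC : SubformulaClosed C)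
    (hN : ∀ s ∈ bounded S C K, s ∈ stage T C (N + 1) → s ∈ stage T C N) {s : Sequent}
    (hs : s ∈ bounded S C K) {A : Formula} (hA : A ∈ C) (h : s ∉ stage T C N) :
    ∃ v : {v : Sequent // v ∈ bounded S C K ∧ v.Irred ∧ ¬ FollowsFrom T (stage T C N) v},
      s.Leaf v.1 := by
  by_contra! hv
  -- If every leaf followed from stage `N`, then `{s}` would be post-fixed for any index `A`,
  -- putting `s` into stage `N + 1`, hence into stage `N`.
  refine h (hN s hs ⟨A, hA, {s}, rfl, ?_⟩)
  rintro t rfl v htv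
  by_contra hf
  exact hv ⟨v, bounded_of_leaf hC htv hs, htv.2, fun h => hf (.inl h)⟩ htv

/-- Irreducible sequents contain no implications, so the induction on `A` must speak of every `s`
having `v` as a leaf. The case that needs the greatest fixed point is `□⁺ A` in the succedent: if it
were true at `v`, both premises would be in stage `N` and `v` would follow from it. -/
theorem canonicalModel_truth (hC : SubformulaClosed C) (hT : T ⊆ C)
    (hK : 5 * multisetSize C.val ≤ K)
    (hN : ∀ s ∈ bounded S C K, s ∈ stage T C (N + 1) → s ∈ stage T C N) (A : Formula)
    (v : {v : Sequent // v ∈ bounded S C K ∧ v.Irred ∧ ¬ FollowsFrom T (stage T C N) v})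
    (s : Sequent) (hs : s.Leaf v.1) :
    (A ∈ s.ante → (canonicalModel T (bounded S C K) (stage T C N)).Sat A v) ∧
      (A ∈ s.succ → ¬ (canonicalModel T (bounded S C K) (stage T C N)).Sat A v) := by
  set M := canonicalModel T (bounded S C K) (stage T C N) with hM
  induction A generalizing v s with
  | var p =>
    refine ⟨fun h => hs.mem_ante h (by simp), fun h h' => v.2.2.2 (.inl (.inl ⟨p, h', ?_⟩))⟩
    exact hs.mem_succ h (by simp)
  | bot =>
    exact ⟨fun h => v.2.2.2 (.inl (.inr (hs.mem_ante h (by simp)))), fun _ h => h⟩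
  | imp A B ihA ihB =>
    constructor
    · intro h hA
      obtain ⟨t, ht, h | h⟩ := hs.imp_mem_ante h
      · exact (ihB v t ht).1 h
      · exact absurd hA ((ihA v t ht).2 h)
    · intro h hAB
      obtain ⟨t, ht, hA, hB⟩ := hs.imp_mem_succ h
      exact (ihB v t ht).2 hB (hAB ((ihA v t ht).1 hA))
  | box A ih =>
    constructor
    · rintro h u ⟨B, hu⟩
      refine (ih u _ hu).1 ?_
      simp [Sequent.premise, hs.mem_ante h]
    · intro h hA
      have hv := hs.mem_succ h (by simp)
      have hAC : A ∈ C := hC.box A (v.2.1.2.2.1 _ hv)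
      obtain ⟨u, hu⟩ := exists_leaf_of_notMem_stage hC hN
        (premise_mem_bounded hC hT hK v.2.1 hAC) hAC
        fun h => v.2.2.2 (.inr (.inl ⟨A, hv, h⟩))
      exact (ih u _ hu).2 (by simp [Sequent.premise]) (hA u ⟨A, hu⟩)
  | boxPlus A ih =>
    constructor
    · intro h u hvu
      have hv : Formula.boxPlus A ∈ v.1.ante := hs.mem_ante h (by simp)
      clear hs h
      induction hvu using Relation.TransGen.head_induction_on with
      | single hu =>
        obtain ⟨B, hu⟩ := hu
        exact (ih _ _ hu).1 (by simp [Sequent.premise, hv])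
      | head hu _ ih' =>
        obtain ⟨B, hu⟩ := hu
        exact ih' (hu.mem_ante (by simp [Sequent.premise, hv]) (by simp))
    · intro h hA
      have hv := hs.mem_succ h (by simp)
      have hAC' : Formula.boxPlus A ∈ C := v.2.1.2.2.1 _ hv
      have hAC : A ∈ C := hC.boxPlus A hAC'
      -- A left premise outside the stage would have a leaf, accessible from `w`, where `A` is
      -- false.
      have hleft : ∀ w, M.Sat (.boxPlus A) w → .boxPlus A ∈ w.1.succ →
          w.1.premise T A ∈ stage T C N := by
        intro w hw hmem
        by_contra hn
        obtain ⟨u, hu⟩ := exists_leaf_of_notMem_stage hC hN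
          (premise_mem_bounded hC hT hK w.2.1 hAC) hAC hn
        exact (ih u _ hu).2 (by simp [Sequent.premise]) (hw u (.single ⟨A, hu⟩))
      -- The witness for `goodSet` collects the sequents with `□⁺ A` on the right at whose
      -- underivable leaves `□⁺ A` is true. This truth passes to successors, so the set is
      -- post-fixed.
      have hright : v.1.premise T (.boxPlus A) ∉ stage T C N := fun h =>
        v.2.2.2 (.inr (.inr ⟨A, hv, hleft v hA hv, h⟩))
      refine hright (hN _ (premise_mem_bounded hC hT hK v.2.1 hAC') ⟨A, hAC,
        {t | t ∈ bounded S C K ∧ .boxPlus A ∈ t.succ ∧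
          ∀ w : {v : Sequent // v ∈ bounded S C K ∧ v.Irred ∧ ¬ FollowsFrom T (stage T C N) v},
            t.Leaf w.1 → M.Sat (.boxPlus A) w}, ?_, ?_⟩)
      · exact ⟨premise_mem_bounded hC hT hK v.2.1 hAC', by simp [Sequent.premise],
          fun w hw u hwu => hA u (.head ⟨_, hw⟩ hwu)⟩
      · rintro t ⟨ht, hmem, hsat⟩ w hw
        by_cases hf : FollowsFrom T (stage T C N) w
        · exact .inl hf
        have hwb := bounded_of_leaf hC hw ht
        have hwm := hw.mem_succ hmem (by simp)
        have hws := hsat ⟨w, hwb, hw.2, hf⟩ hw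
        exact .inr ⟨hwm, hleft ⟨w, hwb, hw.2, hf⟩ hws hwm,
          premise_mem_bounded hC hT hK hwb hAC', by simp [Sequent.premise],
          fun u hu x hux => hws x (.head ⟨_, hu⟩ hux)⟩

/-- Completeness of proof search: if `s` is refuted at no world above which `T` is true, then all
leaves of `s` follow from a stationary stage. -/
theorem good_of_not_refutes (hC : SubformulaClosed C) (hT : T ⊆ C)
    (hK : 5 * multisetSize C.val ≤ K)
    (hN : ∀ s ∈ bounded S C K, s ∈ stage T C (N + 1) → s ∈ stage T C N) {s : Sequent}
    (hs : s ∈ bounded S C K)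
    (hval : ∀ (W : Type) (M : Model W) (w : W), M.Above T w → ¬ M.Refutes w s) (A : Formula) :
    Good T A (stage T C N) (goodSet T A (stage T C N)) s := by
  intro v hv
  by_contra hf
  have htruth := fun A => canonicalModel_truth hC hT hK hN A
  let w : {v : Sequent // v ∈ bounded S C K ∧ v.Irred ∧ ¬ FollowsFrom T (stage T C N) v} :=
    ⟨v, bounded_of_leaf hC hv hs, hv.2, fun h => hf (.inl h)⟩
  refine hval _ (canonicalModel T (bounded S C K) (stage T C N)) w ?_
    ⟨fun A => (htruth A w s hv).1, fun A => (htruth A w s hv).2⟩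
  intro u hu A hA
  -- A world reached in at least one step is a leaf of a modal premise, and `T` is in the antecedent
  -- of that premise.
  obtain ⟨x, -, B, hx⟩ := Relation.TransGen.tail'_iff.1 hu
  exact (htruth A u _ hx).1 (by simp [Sequent.premise, Finset.mem_coe.1 hA])

end Canonical

/-! ### From proof search to a proof -/

/-- The vertices of the proof graph: sequents that are good with respect to a stage `n` and a
formula `A`. -/
structure Vertex (S : Set Formula) (T C : Finset Formula) (K N : ℕ) where
  rank : ℕ
  form : Formula
  seq : Sequent
  rank_le : rank ≤ N
  form_mem : form ∈ C
  seq_mem : seq ∈ bounded S C K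
  good : Good T form (stage T C rank) (goodSet T form (stage T C rank)) seq

namespace Vertex

variable {S : Set Formula} {T C : Finset Formula} {K N : ℕ}

instance : Finite (Vertex S T C K N) := by
  have := (finite_bounded S C K).to_subtype
  refine Finite.of_injective (β := Fin (N + 1) × C × bounded S C K)
    (fun x => (⟨x.rank, Nat.lt_succ_of_le x.rank_le⟩, ⟨x.form, x.form_mem⟩,
      ⟨x.seq, x.seq_mem⟩)) ?_
  rintro ⟨n, A, s, _, _, _, _⟩ ⟨n', A', s', _, _, _, _⟩ h
  simp only [Prod.mk.injEq, Fin.mk.injEq, Subtype.mk.injEq] at h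
  obtain ⟨rfl, rfl, rfl⟩ := h
  rfl

/-- Stage `n + 1` consists of sequents good over stage `n`, so passing to a premise in a stage
lowers the rank. -/
theorem exists_of_mem_stage {n : ℕ} (hn : n ≤ N) {s : Sequent} (hs : s ∈ bounded S C K)
    (h : s ∈ stage T C n) : ∃ x : Vertex S T C K N, x.seq = s ∧ x.rank < n := by
  cases n with
  | zero => exact h.elim
  | succ n =>
    obtain ⟨A, hA, h⟩ := h
    exact ⟨⟨n, A, s, by omega, hA, hs, good_of_mem_goodSet h⟩, rfl, n.lt_succ_self⟩

/-- An irreducible sequent is its own leaf, so goodness names a modal rule or an initial sequent.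
Premises in the stage lower the rank; the right premise in `goodSet` keeps rank and formula. A
reducible sequent passes its goodness to the implication premises, because their leaves are among
its own. -/
theorem exists_next (hC : SubformulaClosed C) (hT : T ⊆ C) (hTS : (T : Set Formula) ⊆ S)
    (hK : 5 * multisetSize C.val ≤ K) (x : Vertex S T C K N) :
    ∃ (r : Rule) (ys : List (Vertex S T C K N)), Inference r (ys.map seq) x.seq ∧
      (∀ A, r ≠ .cut A) ∧ ∀ i y, ys[i]? = some y → y.rank < x.rank ∨
        (y.rank = x.rank ∧ y.form = x.form ∧ ((r = .boxPlus x.form ∧ i = 1) ∨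
          (y.seq.weight < x.seq.weight ∧ ∀ B, r ≠ .box B ∧ r ≠ .boxPlus B))) := by
  have hprem : ∀ A ∈ C, x.seq.premise T A ∈ bounded S C K := fun A hA =>
    premise_mem_bounded hC hT hK x.seq_mem hA
  have hTx : (T : Set Formula) ⊆ x.seq.sig := by rwa [x.seq_mem.1]
  have hsucc := x.seq_mem.2.2.1
  by_cases hx : x.seq.Irred
  · obtain (h | ⟨B, hB, h⟩ | ⟨B, hB, h, h'⟩) | ⟨hB, h, h'⟩ := x.good _ ⟨.refl, hx⟩
    · exact ⟨.init, [], h.inference, by simp, by simp⟩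
    · obtain ⟨y, hy, hlt⟩ := exists_of_mem_stage x.rank_le (hprem B (hC.box B (hsucc _ hB))) h
      refine ⟨.box B, [y], by simpa [hy] using Sequent.inference_box hTx hB, by simp, ?_⟩
      intro i z hz
      obtain rfl : z = y := by simpa using List.mem_of_getElem? hz
      exact .inl hlt
    · obtain ⟨y, hy, hlt⟩ :=
        exists_of_mem_stage x.rank_le (hprem B (hC.boxPlus B (hsucc _ hB))) h
      obtain ⟨y', hy', hlt'⟩ := exists_of_mem_stage x.rank_le (hprem _ (hsucc _ hB)) h'
      refine ⟨.boxPlus B, [y, y'], by simpa [hy, hy'] using Sequent.inference_boxPlus hTx hB,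
        by simp, ?_⟩
      intro i z hz
      obtain rfl | rfl : z = y ∨ z = y' := by simpa using List.mem_of_getElem? hz
      · exact .inl hlt
      · exact .inl hlt'
    · obtain ⟨y, hy, hlt⟩ :=
        exists_of_mem_stage x.rank_le (hprem _ (hC.boxPlus _ (hsucc _ hB))) h
      let y' : Vertex S T C K N := ⟨x.rank, x.form, _, x.rank_le, x.form_mem,
        hprem _ (hsucc _ hB), good_of_mem_goodSet h'⟩
      refine ⟨.boxPlus x.form, [y, y'],
        by simpa [hy] using Sequent.inference_boxPlus hTx hB, by simp, ?_⟩
      intro i z hz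
      match i, hz with
      | 0, hz =>
        obtain rfl : y = z := by simpa using hz
        exact .inl hlt
      | 1, hz =>
        obtain rfl : y' = z := by simpa using hz
        exact .inr ⟨rfl, rfl, .inl ⟨rfl, rfl⟩⟩
  · obtain ⟨r, ps, hinf, hred, hr⟩ := Sequent.exists_inference_of_not_irred hx
    let f : {t // t ∈ ps} → Vertex S T C K N := fun t => ⟨x.rank, x.form, t.1, x.rank_le,
      x.form_mem, bounded_of_red hC (hred _ t.2) x.seq_mem,
      fun v hv => x.good v (hv.of_red (hred _ t.2))⟩
    refine ⟨r, ps.attach.map f, ?_, fun A => (hr A).1, ?_⟩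
    · rw [List.map_map, show seq ∘ f = Subtype.val from rfl, List.attach_map_subtype_val]
      exact hinf
    · intro i z hz
      obtain ⟨t, -, rfl⟩ := List.mem_map.1 (List.mem_of_getElem? hz)
      exact .inr ⟨rfl, rfl, .inr ⟨(hred _ t.2).weight_lt, fun B => (hr B).2⟩⟩

end Vertex

/-- Completeness for regular cut-free ∞-proofs. -/
theorem exists_regular_cutFree_of_not_refutes {s : Sequent} {T : Finset Formula}
    (hT : (T : Set Formula) ⊆ s.sig)
    (hval : ∀ (W : Type) (M : Model W) (w : W), M.Above T w → ¬ M.Refutes w s) :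
    ∃ π : InfProof, π.Proves s ∧ π.CutFree ∧ π.Regular := by
  -- `⊥` is added so that `C` has a member to serve as the arbitrary formula of the root vertex.
  obtain ⟨C, hF, hC⟩ := exists_subformulaClosed
    (insert .bot (T ∪ s.ante.toFinset ∪ s.succ.toFinset))
  obtain ⟨hbot, hF⟩ := Finset.insert_subset_iff.1 hF
  obtain ⟨hF, hsucc⟩ := Finset.union_subset_iff.1 hF
  obtain ⟨hTC, hante⟩ := Finset.union_subset_iff.1 hF
  obtain ⟨K, hK, hs⟩ : ∃ K, 5 * multisetSize C.val ≤ K ∧ s ∈ bounded s.sig C K :=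
    ⟨max (5 * multisetSize C.val) s.weight, le_max_left _ _, rfl,
      fun A hA => hante (Multiset.mem_toFinset.2 hA),
      fun A hA => hsucc (Multiset.mem_toFinset.2 hA), le_max_right _ _⟩
  obtain ⟨N, hN⟩ := exists_stage_stationary T C (finite_bounded s.sig C K)
  choose r next hinf hcut hprog using
    Vertex.exists_next (S := s.sig) (K := K) (N := N) hC hTC hT hK
  exact exists_regular_of_graph Vertex.seq r next hinf hcut Vertex.rank
    (fun x => x.seq.weight) Vertex.form hprog
    ⟨N, .bot, s, le_rfl, hbot, hs, good_of_not_refutes hC hTC hK hN hs hval .bot⟩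

/-! ### Extracting the finite set `T` from a regular proof -/

theorem Inference.sig_eq {r : Rule} {ps : List Sequent} {s : Sequent} (h : Inference r ps s) :
    ∀ q ∈ ps, q.sig = s.sig := by
  cases h <;> simp

theorem InfProof.sig_eq {π : InfProof} {s : Sequent} (hs : π.Proves s) (a : List ℕ) (m : Mark)
    (hm : π.node a = some m) : m.sequent.sig = s.sig := by
  induction a using List.reverseRecOn generalizing m with
  | nil =>
    rw [InfProof.Proves, hm] at hs
    rw [← Option.some.inj hs]
  | append_singleton a i ih =>
    cases ha : π.node a with
    | none => simp [π.node_closed a i ha] at hm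
    | some m' =>
      obtain ⟨ps, hinf, hps⟩ := π.inference a m' ha
      have hi := (hps i).symm
      rw [hm] at hi
      rw [hinf.sig_eq _ (List.mem_of_getElem? hi), ih m' ha]

/-- Only finitely many marks occur in a regular ∞-proof. -/
theorem InfProof.Regular.finite_marks {π : InfProof} (h : π.Regular) :
    {m | ∃ a, π.node a = some m}.Finite := by
  refine Set.Finite.of_finite_image (f := some) ((Set.Finite.image (fun t => t []) h).subset ?_)
    (Option.some_injective _).injOn
  rintro _ ⟨m, ⟨a, ha⟩, rfl⟩
  exact ⟨π.subtree a, ⟨a, by simp [ha], rfl⟩, by simp [subtree, ha]⟩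

end KPlus

theorem mainTheorem4 (s : KPlus.Sequent)
    (h : ∃ π : KPlus.InfProof, π.Proves s ∧ π.Regular) :
    ∃ π : KPlus.InfProof, π.Proves s ∧ π.CutFree ∧ π.Regular := by
  obtain ⟨π, hs, hπ⟩ := h
  have hfin : (⋃ m ∈ {m | ∃ a, π.node a = some m}, {A | A ∈ m.sequent.ante}).Finite :=
    hπ.finite_marks.biUnion fun m _ => m.sequent.ante.toFinset.finite_toSet.subset
      fun A hA => Multiset.mem_toFinset.2 hA
  -- Since `Σ` is constant throughout the proof, this single `T` serves all nodes.
  obtain ⟨T, hT⟩ := (hfin.inter_of_left s.sig).exists_finset_coe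
  refine KPlus.exists_regular_cutFree_of_not_refutes (T := T)
    (hT ▸ Set.inter_subset_right) fun W M w hw => KPlus.InfProof.not_refutes hs ?_ M hw
  intro a m hm A hA hAs
  rw [hT]
  exact ⟨Set.mem_biUnion (show m ∈ {m | ∃ a, π.node a = some m} from ⟨a, hm⟩) hA,
    KPlus.InfProof.sig_eq hs a m hm ▸ hAs⟩
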